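/- Fix an integer $d\ge 1$ and an integer $B\ge 1$. An instance $\mathcal I$ of $[0,1]$ $d$-dimensional online vector bin packing (OVBP) with bin size $B$ is a finite sequence of vectors in $[0,1]^d$; a packing is a partition of the vectors into bins such that in each bin the vectors sum, coordinatewise, to at most $(B,\dots,B)$, and $\mathrm{OPT}(\mathcal I)$ is the minimum number of bins in a packing. A (deterministic) online algorithm $\mathrm{ALG}$ receives the vectors one by one and irrevocably assigns each vector on arrival to a bin, knowing only the vectors that have arrived so far, and keeps all bins feasible; $\mathrm{ALG}(\mathcal I)$ is the number of bins it uses, and its competitive ratio on $\mathcal I$ is $\mathrm{ALG}(\mathcal I)/\mathrm{OPT}(\mathcal I)$. FirstFit puts each vector into the first opened bin that can accommodate it, and opens a new bin if there is none. **Theorem.** Let $d\ge 1$. 1. For $B=1$ there is an instance $\mathcal I$ with $\mathrm{OPT}(\mathcal I)=2$ on which the competitive ratio of FirstFit is at least $d/4$. 2. Let $d\ge 5$. For $B=1$ and every online algorithm $\mathrm{ALG}$ there is an instance $\mathcal I$ with $\mathrm{OPT}(\mathcal I)\le\log_2 d$ and $$\frac{\mathrm{ALG}(\mathcal I)}{\mathrm{OPT}(\mathcal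 I)}>\frac{2d}{(\log_2 d)^2}.$$ 3. For every integer $B\ge 2$ and every online algorithm $\mathrm{ALG}$ there is an instance $\mathcal I$ with $\mathrm{OPT}(\mathcal I)=2$ and $$\frac{\mathrm{ALG}(\mathcal I)}{\mathrm{OPT}(\mathcal I)}>\frac{(B!\cdot d)^{1/B}-1}{2B}.$$ -/

import Mathlib

/-! Online vector bin packing with items in `[0,1]^d` and bin size `B`. -/

namespace OVBP

/-- A `d`-dimensional vector. -/
abbrev Item (d : ℕ) : Type := Fin d → ℝ

/-- An instance is the list of its vectors in order of arrival; all entries lie in `[0,1]`. -/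
def IsInstance {d : ℕ} (I : List (Item d)) : Prop :=
  ∀ v ∈ I, ∀ j, v j ∈ Set.Icc (0 : ℝ) 1

/-- `c` assigns to every item of `I` the label of its bin. The packing is feasible if in every
bin the vectors sum to at most `(B, …, B)`. -/
def IsPacking {d : ℕ} (B : ℕ) (I : List (Item d)) (c : Fin I.length → ℕ) : Prop :=
  ∀ (b : ℕ) (j : Fin d), ∑ i : Fin I.length with c i = b, I.get i j ≤ (B : ℝ)

/-- The number of bins that are used by an assignment. -/
def numBins {n : ℕ} (c : Fin n → ℕ) : ℕ :=
  (Finset.univ.image c).card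

/-- The least number of bins in a feasible packing of `I`. -/
noncomputable def opt {d : ℕ} (B : ℕ) (I : List (Item d)) : ℕ :=
  sInf {m | ∃ c : Fin I.length → ℕ, IsPacking B I c ∧ numBins c = m}

/-- A deterministic online rule: from the vectors that arrived before (in order) and the current
vector it computes the label of the bin for the current vector. Its own earlier choices are
functions of the earlier vectors. -/
abbrev OnlineRule (d : ℕ) : Type := List (Item d) → Item d → ℕ

/-- The assignment that the rule produces on `I`. -/
def run {d : ℕ} (A : OnlineRule d) (I : List (Item d)) : Fin I.length → ℕ :=
  fun i => A (I.take i) (I.get i)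

/-- An online algorithm for bin size `B` is an online rule that keeps all bins feasible on every
instance (hence at every time, as prefixes of instances are instances). -/
def IsOnlineAlgorithm {d : ℕ} (B : ℕ) (A : OnlineRule d) : Prop :=
  ∀ I : List (Item d), IsInstance I → IsPacking B I (run A I)

/-- The competitive ratio `ALG(I) / OPT(I)` of a rule on the instance `I`. -/
noncomputable def ratio {d : ℕ} (B : ℕ) (A : OnlineRule d) (I : List (Item d)) : ℝ :=
  (numBins (run A I) : ℝ) / (opt B I : ℝ)

/-- Given the current loads `L b` of the bins `b = 0, 1, 2, …`, the first bin that can accommodate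
`v`. Bins are opened in the order `0, 1, 2, …` and an unopened bin has load `0`, so this is the
first opened bin with enough room, and the next new bin if there is none. -/
noncomputable def firstFitBin {d : ℕ} (B : ℕ) (L : ℕ → Item d) (v : Item d) : ℕ :=
  sInf {b | ∀ j, L b j + v j ≤ (B : ℝ)}

/-- The loads of the bins after FirstFit has packed the given list of vectors in order. -/
noncomputable def firstFitLoad {d : ℕ} (B : ℕ) (past : List (Item d)) : ℕ → Item d :=
  past.foldl
    (fun L v => Function.update L (firstFitBin B L v) (L (firstFitBin B L v) + v))
    (fun _ => 0)

/-- The FirstFit algorithm. -/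
noncomputable def firstFit (d B : ℕ) : OnlineRule d :=
  fun past v => firstFitBin B (firstFitLoad B past) v

end OVBP

namespace OVBP
open Finset

/-! ### Instances as prefixes of sequences, and estimates of the optimum -/

variable {d : ℕ}

/-! In all general constructions an item has entry 1 on the coordinates it owns, and a tiny positive
entry on a coordinate bars an item from bins that are already full there. The tiny entries are so
small that all of them together add up to at most 1, so offline they only matter next to large ones.

FirstFit: after `e_b` and `(1/d)(1 - e_b)` share a bin, neither type of later crown item fits there,
so `d` bins open; two bins suffice offline.

`B ≥ 2` (`FullBinGame`): take `N` items with `N.choose B ≤ d`, so that every `B`-set of times owns a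
coordinate. Once the algorithm has gathered such a set in one bin, all later items are tiny but
positive there, so no bin exceeds `B` items and at least `N / B` bins open. Offline, split each bin
into its first item and the rest: each half of a full bin has at most `B - 1` ones, which leaves
room for the tiny entries.

`B = 1` (`ColorGame`): the adversary secretly colours the items with `k` colours; colour classes are
the offline bins and every bin of the algorithm is rainbow. While fewer than `|F|` bins are open,
some colour set `S` in the family `F` is not the colour set of a bin. The next item is barred from
bins having a colour outside `S`, so its bin misses a colour of `S`, which becomes its colour.
Taking for `F` the nonempty sets of at most `m` colours forces `|F|` or `(d + 1) / m` bins against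
an optimum of at most `k`. With `k = ⌊log₂ d⌋`, `m = ⌊k/2⌋` this suffices for `d ≥ 64`; for `16 ≤ d
< 64` one uses `k = 4` with tuned `m`, and for `5 ≤ d < 16` an explicit decision tree. -/

/-- The instance formed by the first `n` terms of a sequence of vectors. -/
def seq (x : ℕ → Item d) (n : ℕ) : List (Item d) := (List.range n).map x

/-- The label that the rule `A` gives to the `t`-th term of a sequence of vectors. -/
def lab (A : OnlineRule d) (x : ℕ → Item d) (t : ℕ) : ℕ := A (seq x t) (x t)

/-- Feasibility of an assignment of the first `n` terms of a sequence. -/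
def Feasible (B : ℕ) (x : ℕ → Item d) (n : ℕ) (c : ℕ → ℕ) : Prop :=
  ∀ (b : ℕ) (j : Fin d), ∑ i ∈ range n with c i = b, x i j ≤ (B : ℝ)

@[simp] lemma length_seq (x : ℕ → Item d) (n : ℕ) : (seq x n).length = n := by simp [seq]

lemma seq_succ (x : ℕ → Item d) (n : ℕ) : seq x (n + 1) = seq x n ++ [x n] := by
  simp [seq, List.range_succ]

lemma seq_congr {x y : ℕ → Item d} {n : ℕ} (h : ∀ i < n, x i = y i) : seq x n = seq y n :=
  List.map_congr_left fun i hi => h i (List.mem_range.1 hi)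

lemma lab_congr (A : OnlineRule d) {x y : ℕ → Item d} {t : ℕ} (h : ∀ i ≤ t, x i = y i) :
    lab A x t = lab A y t := by
  rw [lab, lab, seq_congr fun i hi => h i hi.le, h t le_rfl]

lemma lab_update (A : OnlineRule d) (x : ℕ → Item d) {t n : ℕ} (h : t < n) (v : Item d) :
    lab A (Function.update x n v) t = lab A x t :=
  lab_congr A fun i hi => Function.update_of_ne (by omega) _ _

lemma get_seq (x : ℕ → Item d) (n : ℕ) (i : Fin (seq x n).length) : (seq x n).get i = x i := by
  rw [List.get_eq_getElem]
  simp only [seq, List.getElem_map, List.getElem_range]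

lemma isInstance_seq {x : ℕ → Item d} {n : ℕ} :
    IsInstance (seq x n) ↔ ∀ i < n, ∀ j, x i j ∈ Set.Icc (0 : ℝ) 1 := by
  simp [IsInstance, seq]

lemma isPacking_seq {B : ℕ} {x : ℕ → Item d} {n : ℕ} {c : Fin (seq x n).length → ℕ} {c' : ℕ → ℕ}
    (h : ∀ i, c i = c' i) : IsPacking B (seq x n) c ↔ Feasible B x n c' := by
  refine forall_congr' fun b => forall_congr' fun j => ?_
  have : ∑ i : Fin (seq x n).length with c i = b, (seq x n).get i j
      = ∑ i ∈ range n with c' i = b, x i j := by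
    refine Finset.sum_nbij (fun i => (i : ℕ)) ?_ ?_ ?_ ?_
    · intro i hi
      have := i.2
      simp only [mem_filter, mem_univ, true_and, mem_range, h] at hi ⊢
      exact ⟨by simpa using this, hi⟩
    · intro i _ k _ hik
      exact Fin.ext hik
    · intro i hi
      simp only [coe_filter, mem_range, Set.mem_ofPred_eq] at hi
      exact ⟨⟨i, by simpa using hi.1⟩, by simp [h, hi.2], rfl⟩
    · intro i _
      rw [get_seq]
  rw [this]

lemma card_image_seq {x : ℕ → Item d} {n : ℕ} {c : Fin (seq x n).length → ℕ} {c' : ℕ → ℕ}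
    (h : ∀ i, c i = c' i) : numBins c = ((range n).image c').card := by
  rw [numBins]
  congr 1
  ext b
  simp only [mem_image, mem_univ, true_and, mem_range, h]
  constructor
  · rintro ⟨i, hi⟩
    exact ⟨i, by simpa using i.2, hi⟩
  · rintro ⟨i, hi, hb⟩
    exact ⟨⟨i, by simpa using hi⟩, hb⟩

lemma run_seq (A : OnlineRule d) (x : ℕ → Item d) (n : ℕ) (i : Fin (seq x n).length) :
    run A (seq x n) i = lab A x i := by
  have hi : (i : ℕ) ≤ n := by simpa using i.2.le
  have h1 : (seq x n).take i = seq x i := by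
    simp [seq, ← List.map_take, List.take_range, hi]
  rw [run, lab, h1, get_seq]

lemma numBins_run (A : OnlineRule d) (x : ℕ → Item d) (n : ℕ) :
    numBins (run A (seq x n)) = ((range n).image (lab A x)).card :=
  card_image_seq (run_seq A x n)

lemma IsOnlineAlgorithm.feasible {B : ℕ} {A : OnlineRule d} (hA : IsOnlineAlgorithm B A)
    {x : ℕ → Item d} {n : ℕ} (hx : ∀ i < n, ∀ j, x i j ∈ Set.Icc (0 : ℝ) 1) :
    Feasible B x n (lab A x) :=
  (isPacking_seq (run_seq A x n)).1 (hA _ (isInstance_seq.2 hx))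

/-- Items that share a bin fit together. -/
lemma Feasible.sum_le {B : ℕ} {x : ℕ → Item d} {n : ℕ} {c : ℕ → ℕ} (h : Feasible B x n c)
    (hx : ∀ i < n, ∀ j, x i j ∈ Set.Icc (0 : ℝ) 1) {b : ℕ} {T : Finset ℕ}
    (hT : ∀ i ∈ T, i < n ∧ c i = b) (j : Fin d) : ∑ i ∈ T, x i j ≤ (B : ℝ) := by
  refine (Finset.sum_le_sum_of_subset_of_nonneg ?_ ?_).trans (h b j)
  · intro i hi
    simpa using hT i hi
  · intro i hi _
    simp only [mem_filter, mem_range] at hi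
    exact (hx i hi.1 j).1

lemma opt_seq_le {B : ℕ} {x : ℕ → Item d} {n : ℕ} {c : ℕ → ℕ} (h : Feasible B x n c) :
    opt B (seq x n) ≤ ((range n).image c).card :=
  Nat.sInf_le ⟨fun i => c i, (isPacking_seq fun _ => rfl).2 h, card_image_seq fun _ => rfl⟩

lemma opt_seq_le_of_lt {B : ℕ} {x : ℕ → Item d} {n k : ℕ} {c : ℕ → ℕ} (h : Feasible B x n c)
    (hc : ∀ i < n, c i < k) : opt B (seq x n) ≤ k := by
  refine (opt_seq_le h).trans ?_
  have : (range n).image c ⊆ range k := by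
    intro b hb
    simp only [mem_image, mem_range] at hb ⊢
    obtain ⟨i, hi, rfl⟩ := hb
    exact hc i hi
  simpa using card_le_card this

/-- One bin per item is feasible, so the infimum in `opt` ranges over a nonempty set and is attained
instead of being the default value 0. -/
lemma exists_feasible_opt {B : ℕ} (hB : 1 ≤ B) {x : ℕ → Item d} {n : ℕ}
    (hx : ∀ i < n, ∀ j, x i j ∈ Set.Icc (0 : ℝ) 1) :
    ∃ c : ℕ → ℕ, Feasible B x n c ∧ ((range n).image c).card = opt B (seq x n) := by
  have hB' : (1 : ℝ) ≤ B := by exact_mod_cast hB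
  have hne : {m | ∃ c : Fin (seq x n).length → ℕ, IsPacking B (seq x n) c ∧ numBins c = m}.Nonempty := by
    refine ⟨_, fun i => (i : ℕ), (isPacking_seq (c' := fun i => i) fun _ => rfl).2 ?_, rfl⟩
    intro b j
    by_cases hb : b < n
    · have : (range n).filter (fun i => i = b) = {b} := by
        ext i; simp only [mem_filter, mem_range, mem_singleton]; omega
      rw [this, sum_singleton]
      exact (hx b hb j).2.trans hB'
    · have : (range n).filter (fun i => i = b) = ∅ := by
        ext i; simp only [mem_filter, mem_range, notMem_empty, iff_false]; omega
      rw [this, sum_empty]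
      linarith
  obtain ⟨c, hc, hcard⟩ := Nat.sInf_mem hne
  let c' : ℕ → ℕ := fun i => if h : i < (seq x n).length then c ⟨i, h⟩ else 0
  have hcc : ∀ i, c i = c' i := fun i => by simp only [c', i.2, dif_pos]
  exact ⟨c', (isPacking_seq hcc).1 hc, (card_image_seq hcc).symm.trans hcard⟩

lemma opt_seq_pos {B : ℕ} (hB : 1 ≤ B) {x : ℕ → Item d} {n : ℕ} (hn : 0 < n)
    (hx : ∀ i < n, ∀ j, x i j ∈ Set.Icc (0 : ℝ) 1) : 0 < opt B (seq x n) := by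
  obtain ⟨c, -, hc⟩ := exists_feasible_opt hB hx
  rw [← hc, card_pos, image_nonempty]
  exact ⟨0, by simpa using hn⟩

lemma opt_seq_succ_le {B : ℕ} (hB : 1 ≤ B) {x : ℕ → Item d} {n : ℕ}
    (hx : ∀ i < n + 1, ∀ j, x i j ∈ Set.Icc (0 : ℝ) 1) :
    opt B (seq x (n + 1)) ≤ opt B (seq x n) + 1 := by
  obtain ⟨c, hf, hc⟩ := exists_feasible_opt hB fun i hi => hx i (Nat.lt_succ_of_lt hi)
  have hB' : (1 : ℝ) ≤ B := by exact_mod_cast hB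
  obtain ⟨b₀, hb₀⟩ := Infinite.exists_notMem_finset ((range n).image c)
  have hne : ∀ i < n, c i ≠ b₀ := fun i hi h =>
    hb₀ (mem_image.2 ⟨i, mem_range.2 hi, h⟩)
  have hfe : Feasible B x (n + 1) (Function.update c n b₀) := by
    intro b j
    by_cases hb : b = b₀
    · subst hb
      have : (range (n + 1)).filter (fun i => Function.update c n b i = b) = {n} := by
        ext i
        simp only [mem_filter, mem_range, mem_singleton]
        constructor
        · rintro ⟨h1, h2⟩
          by_contra hin
          rw [Function.update_of_ne hin] at h2
          exact hne i (by omega) h2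
        · rintro rfl
          simp
      rw [this, sum_singleton]
      exact (hx n n.lt_succ_self j).2.trans hB'
    · have : (range (n + 1)).filter (fun i => Function.update c n b₀ i = b)
          = (range n).filter (fun i => c i = b) := by
        ext i
        simp only [mem_filter, mem_range]
        constructor
        · rintro ⟨h1, h2⟩
          have hin : i ≠ n := by
            rintro rfl
            exact hb (by simpa using h2.symm)
          rw [Function.update_of_ne hin] at h2
          exact ⟨by omega, h2⟩
        · rintro ⟨h1, h2⟩
          rw [Function.update_of_ne (by omega)]
          exact ⟨by omega, h2⟩
      rw [this]
      exact hf b j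
  refine (opt_seq_le hfe).trans ?_
  rw [← hc]
  refine (card_le_card (t := insert b₀ ((range n).image c)) ?_).trans (card_insert_le _ _)
  intro b hb
  simp only [mem_image, mem_range, mem_insert] at hb ⊢
  obtain ⟨i, hi, rfl⟩ := hb
  by_cases hin : i = n
  · subst hin; simp
  · right
    exact ⟨i, by omega, by rw [Function.update_of_ne hin]⟩

lemma two_le_opt_seq {B : ℕ} (hB : 1 ≤ B) {x : ℕ → Item d} {n : ℕ}
    (hx : ∀ i < n, ∀ j, x i j ∈ Set.Icc (0 : ℝ) 1) {j : Fin d}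
    (h : (B : ℝ) < ∑ i ∈ range n, x i j) : 2 ≤ opt B (seq x n) := by
  obtain ⟨c, hf, hc⟩ := exists_feasible_opt hB hx
  by_contra hlt
  rw [← hc] at hlt
  obtain ⟨b, hb⟩ := card_le_one_iff_subset_singleton.1 (by omega : ((range n).image c).card ≤ 1)
  have := hf.sum_le hx (b := b) (T := range n)
    (fun i hi => ⟨mem_range.1 hi, by simpa using hb (mem_image_of_mem c hi)⟩) j
  linarith

/-- An instance that fits into two bins extends to one that needs exactly two. -/
lemma exists_opt_eq_two {B : ℕ} (hB : 1 ≤ B) (hd : 1 ≤ d) {x : ℕ → Item d} {n : ℕ}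
    (hx : ∀ i < n, ∀ j, x i j ∈ Set.Icc (0 : ℝ) 1) (h2 : opt B (seq x n) ≤ 2) :
    ∃ (y : ℕ → Item d) (m : ℕ), (∀ i < n, y i = x i) ∧ n ≤ m ∧ IsInstance (seq y m) ∧
      opt B (seq y m) = 2 := by
  let y : ℕ → Item d := fun i => if i < n then x i else fun _ => 1
  have hyx : ∀ i < n, y i = x i := fun i hi => by simp [y, hi]
  have hy : ∀ i j, y i j ∈ Set.Icc (0 : ℝ) 1 := by
    intro i j
    by_cases hi : i < n
    · rw [hyx i hi]; exact hx i hi j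
    · simp [y, hi]
  have hex : ∃ k, 2 ≤ opt B (seq y (n + k)) := by
    refine ⟨B + 1, two_le_opt_seq hB (fun i _ => hy i) (j := ⟨0, hd⟩) ?_⟩
    rw [sum_range_add]
    have h1 : 0 ≤ ∑ i ∈ range n, y i ⟨0, hd⟩ := sum_nonneg fun i _ => (hy i _).1
    have h3 : ∑ i ∈ range (B + 1), y (n + i) ⟨0, hd⟩ = B + 1 := by
      rw [sum_congr rfl (g := fun _ => (1 : ℝ)) fun i _ => by simp [y]]
      simp
    linarith
  classical
  -- Stop at the first moment when the optimum reaches two: each all-one vector raises it by at most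
  -- one, so it cannot jump past two.
  refine ⟨y, n + Nat.find hex, hyx, Nat.le_add_right _ _, isInstance_seq.2 fun i _ => hy i,
    le_antisymm ?_ (Nat.find_spec hex)⟩
  rcases hk : Nat.find hex with _ | k
  · rw [Nat.add_zero, seq_congr hyx]; exact h2
  · have := Nat.find_min hex (m := k) (by omega)
    have := opt_seq_succ_le hB (x := y) (n := n + k) fun i _ => hy i
    rw [← add_assoc]
    omega

/-- A sequence that fits into two bins, but on which `A` opens `N` bins, gives an instance with
optimum two and ratio at least `N / 2`. -/
lemma exists_ratio_of_opt_le_two {B : ℕ} (hB : 1 ≤ B) (hd : 1 ≤ d) (A : OnlineRule d)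
    {x : ℕ → Item d} {n N : ℕ} (hx : ∀ i < n, ∀ j, x i j ∈ Set.Icc (0 : ℝ) 1)
    (h2 : opt B (seq x n) ≤ 2) (hN : N ≤ ((range n).image (lab A x)).card) :
    ∃ I : List (Item d), IsInstance I ∧ opt B I = 2 ∧ (N : ℝ) / 2 ≤ ratio B A I := by
  obtain ⟨y, m, hyx, hnm, hI, hopt⟩ := exists_opt_eq_two hB hd hx h2
  refine ⟨seq y m, hI, hopt, ?_⟩
  rw [ratio, hopt, numBins_run]
  have : N ≤ ((range m).image (lab A y)).card := by
    refine hN.trans (card_le_card ?_)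
    intro b hb
    simp only [mem_image, mem_range] at hb ⊢
    obtain ⟨i, hi, rfl⟩ := hb
    exact ⟨i, by omega, lab_congr A fun k hk => hyx k (by omega)⟩
  have : (N : ℝ) ≤ (((range m).image (lab A y)).card : ℕ) := by exact_mod_cast this
  push_cast
  gcongr

/-! ### FirstFit on the crown -/

/-- The crown: the unit vectors `e_0, e_1, …`, each followed by `(1/d)(1 - e_i)`. -/
noncomputable def crown (d : ℕ) (n : ℕ) : Item d := fun j =>
  if n % 2 = 0 then (if (j : ℕ) = n / 2 then 1 else 0)
  else (if (j : ℕ) = n / 2 then 0 else 1 / d)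

lemma crown_even (i : ℕ) (j : Fin d) : crown d (2 * i) j = if (j : ℕ) = i then 1 else 0 := by
  simp [crown]

lemma crown_odd (i : ℕ) (j : Fin d) :
    crown d (2 * i + 1) j = if (j : ℕ) = i then 0 else 1 / (d : ℝ) := by
  have h1 : (2 * i + 1) % 2 = 1 := by omega
  have h2 : (2 * i + 1) / 2 = i := by omega
  simp [crown, h1, h2]

lemma firstFitLoad_seq_succ (B : ℕ) (x : ℕ → Item d) (n : ℕ) :
    firstFitLoad B (seq x (n + 1)) = Function.update (firstFitLoad B (seq x n))
      (lab (firstFit d B) x n) (firstFitLoad B (seq x n) (lab (firstFit d B) x n) + x n) := by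
  rw [seq_succ, firstFitLoad, List.foldl_append]
  rfl

lemma firstFitBin_eq {B : ℕ} {L : ℕ → Item d} {v : Item d} {b : ℕ}
    (h : ∀ j, L b j + v j ≤ (B : ℝ)) (h' : ∀ b' < b, ∃ j, (B : ℝ) < L b' j + v j) :
    firstFitBin B L v = b := by
  refine le_antisymm (Nat.sInf_le h) (le_csInf ⟨b, h⟩ fun b' hb' => ?_)
  by_contra hlt
  obtain ⟨j, hj⟩ := h' b' (by omega)
  exact absurd (hb' j) (not_le.2 hj)

/-- An earlier bin `b` has load 1 at coordinate `b` and `1/d` elsewhere. So `e_i` overflows it at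
coordinate `i`, and `(1/d)(1 - e_i)` overflows it at coordinate `b`. -/
lemma firstFit_crown {i : ℕ} (hi : i ≤ d) :
    (firstFitLoad 1 (seq (crown d) (2 * i)) = fun b =>
        if b < i then crown d (2 * b) + crown d (2 * b + 1) else 0) ∧
      ∀ k < i, lab (firstFit d 1) (crown d) (2 * k) = k := by
  induction i with
  | zero => exact ⟨by funext b; simp [seq, firstFitLoad], by simp⟩
  | succ i ih =>
    obtain ⟨hL, hlab⟩ := ih (by omega)
    have hd : (0 : ℝ) < d := by exact_mod_cast (by omega : 0 < d)
    have hd1 : 1 / (d : ℝ) ≤ 1 := by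
      rw [div_le_one hd]; exact_mod_cast (by omega : 1 ≤ d)
    have hpos : 0 < 1 / (d : ℝ) := by positivity
    have ha : lab (firstFit d 1) (crown d) (2 * i) = i := by
      refine firstFitBin_eq (fun j => ?_) fun b hb => ⟨⟨i, by omega⟩, ?_⟩
      · rw [hL, crown_even]
        simp only [lt_irrefl, if_false, Pi.zero_apply]
        split_ifs <;> simp
      · have hib : i ≠ b := by omega
        rw [hL]
        simp only [hb, if_true, Pi.add_apply, crown_even, crown_odd, hib, if_false]
        push_cast
        linarith
    have hL1 := firstFitLoad_seq_succ 1 (crown d) (2 * i)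
    rw [ha] at hL1
    have hLi : firstFitLoad 1 (seq (crown d) (2 * i)) i = 0 := by rw [hL]; simp
    rw [hLi, zero_add] at hL1
    have hb : lab (firstFit d 1) (crown d) (2 * i + 1) = i := by
      refine firstFitBin_eq (fun j => ?_) fun b hb => ⟨⟨b, by omega⟩, ?_⟩
      · rw [hL1, Function.update_self, crown_even, crown_odd, Nat.cast_one]
        split_ifs <;> linarith
      · have hbi : b ≠ i := by omega
        rw [hL1, Function.update_of_ne hbi, hL]
        simp only [hb, if_true, Pi.add_apply, crown_even, crown_odd, hbi, if_false]
        push_cast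
        linarith
    constructor
    · rw [(by ring : 2 * (i + 1) = 2 * i + 1 + 1), firstFitLoad_seq_succ, hb, hL1, hL]
      funext b
      rcases lt_trichotomy b i with h | h | h
      · rw [Function.update_of_ne (by omega), Function.update_of_ne (by omega), if_pos h,
          if_pos (by omega)]
      · subst h
        simp
      · rw [Function.update_of_ne (by omega), Function.update_of_ne (by omega), if_neg (by omega),
          if_neg (by omega)]
    · intro k hk
      rcases Nat.lt_succ_iff_lt_or_eq.1 hk with h | h
      · exact hlab k h
      · rw [h, ha]

lemma crown_mem_Icc (n : ℕ) (j : Fin d) : crown d n j ∈ Set.Icc (0 : ℝ) 1 := by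
  have hd : (1 : ℝ) ≤ d := by exact_mod_cast (by have := j.2; omega : 1 ≤ d)
  have : 1 / (d : ℝ) ≤ 1 := by rw [div_le_one (by linarith)]; exact hd
  have : 0 ≤ 1 / (d : ℝ) := by positivity
  rw [crown, Set.mem_Icc]
  split_ifs <;> constructor <;> linarith

lemma feasible_crown : Feasible 1 (crown d) (2 * d) (fun n => n % 2) := by
  intro b j
  have hd : (0 : ℝ) < d := by exact_mod_cast (by have := j.2; omega : 0 < d)
  have hrange : ∀ n : ℕ, ∑ i ∈ range (2 * n) with i % 2 = b, crown d i j
      = ∑ i ∈ range n, ((if b = 0 then crown d (2 * i) j else 0)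
          + if b = 1 then crown d (2 * i + 1) j else 0) := by
    intro n
    induction n with
    | zero => simp
    | succ n ih =>
      rw [sum_range_succ, ← ih, (by ring : 2 * (n + 1) = 2 * n + 1 + 1), sum_filter, sum_filter,
        sum_range_succ, sum_range_succ, add_assoc]
      have h1 : 2 * n % 2 = 0 := by omega
      have h2 : (2 * n + 1) % 2 = 1 := by omega
      rw [h1, h2]
      simp only [eq_comm]
  rw [hrange]
  by_cases h0 : b = 0
  · subst h0
    simp only [crown_even, if_true, zero_ne_one, if_false, add_zero, sum_ite_eq, mem_range]
    split_ifs <;> simp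
  · by_cases h1 : b = 1
    · subst h1
      simp only [crown_odd, if_true, one_ne_zero, if_false, zero_add]
      calc ∑ i ∈ range d, (if (j : ℕ) = i then 0 else 1 / (d : ℝ))
          ≤ ∑ i ∈ range d, 1 / (d : ℝ) := by
            refine sum_le_sum fun i _ => ?_
            split_ifs
            · positivity
            · exact le_rfl
        _ = ((1 : ℕ) : ℝ) := by simp [hd.ne']
    · simp [h0, h1]

theorem firstFit_lower_bound (hd : 1 ≤ d) :
    ∃ I : List (Item d), IsInstance I ∧ opt 1 I = 2 ∧
      (d : ℝ) / 4 ≤ ratio 1 (firstFit d 1) I := by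
  obtain ⟨I, hI, hopt, hr⟩ := exists_ratio_of_opt_le_two (B := 1) le_rfl hd (firstFit d 1)
    (x := crown d) (n := 2 * d) (N := d) (fun i _ => crown_mem_Icc i)
    (opt_seq_le_of_lt feasible_crown fun i _ => Nat.mod_lt _ two_pos) (by
      have : range d ⊆ (range (2 * d)).image (lab (firstFit d 1) (crown d)) := by
        intro k hk
        rw [mem_range] at hk
        exact mem_image.2 ⟨2 * k, by simpa using hk, (firstFit_crown le_rfl).2 k hk⟩
      simpa using card_le_card this)
  refine ⟨I, hI, hopt, le_trans ?_ hr⟩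
  have : (0 : ℝ) ≤ d := by positivity
  linarith

/-! ### Bin size at least two: charging full bins -/

/-- The invariant of the adversary for bin size at least two. The coordinate `j` belongs to the
set `g j` of times, and is charged later exactly when `g j` fills a bin. -/
structure FullBinGame (A : OnlineRule d) (B N : ℕ) (g : Fin d → Finset ℕ) (x : ℕ → Item d)
    (n : ℕ) : Prop where
  mem_Icc : ∀ t j, x t j ∈ Set.Icc (0 : ℝ) 1
  small : ∀ t < n, ∀ j, t ∉ g j → x t j ≤ 1 / (N + 1)
  own : ∀ t < n, ∀ j, t ∈ g j → x t j = 1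
  full : ∀ t < n, ∀ j, t ∉ g j → x t j ≠ 0 → ∃ b, ∀ s ∈ g j, s < n ∧ lab A x s = b
  card_le : ∀ b, #{t ∈ range n | lab A x t = b} ≤ B

lemma FullBinGame.step {A : OnlineRule d} {B N : ℕ} (hA : IsOnlineAlgorithm B A)
    {g : Fin d → Finset ℕ} (hg : ∀ S ∈ powersetCard B (range N), ∃ j, g j = S)
    {x : ℕ → Item d} {n : ℕ} (hn : n < N) (h : FullBinGame A B N g x n) :
    ∃ y, FullBinGame A B N g y (n + 1) := by
  classical
  have hε : (0 : ℝ) < 1 / (N + 1) := by positivity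
  have hε1 : 1 / (N + 1 : ℝ) ≤ 1 := by
    rw [div_le_one (by positivity)]
    linarith [(Nat.cast_nonneg N : (0 : ℝ) ≤ N)]
  let v : Item d := fun j => if n ∈ g j then 1 else
    if ∃ b, ∀ s ∈ g j, s < n ∧ lab A x s = b then 1 / (N + 1) else 0
  have hv : ∀ j, v j ∈ Set.Icc (0 : ℝ) 1 := by
    intro j
    simp only [v, Set.mem_Icc]
    split_ifs <;> constructor <;> linarith
  let y := Function.update x n v
  have hyn : y n = v := Function.update_self _ _ _
  have hyt : ∀ t, t ≠ n → y t = x t := fun t ht => Function.update_of_ne ht _ _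
  have hlab : ∀ t < n, lab A y t = lab A x t := fun t ht => lab_update A x ht v
  have hy : ∀ t j, y t j ∈ Set.Icc (0 : ℝ) 1 := by
    intro t j
    by_cases ht : t = n
    · rw [ht, hyn]; exact hv j
    · rw [hyt t ht]; exact h.mem_Icc t j
  have hfilter : ∀ b, {t ∈ range n | lab A y t = b} = {t ∈ range n | lab A x t = b} := fun b =>
    filter_congr fun t ht => by rw [hlab t (mem_range.1 ht)]
  refine ⟨y, hy, ?_, ?_, ?_, ?_⟩
  · intro t ht j hj
    rcases Nat.lt_succ_iff_lt_or_eq.1 ht with ht | rfl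
    · rw [hyt t ht.ne]; exact h.small t ht j hj
    · rw [hyn]
      simp only [v, hj, if_false]
      split_ifs
      · exact le_rfl
      · exact hε.le
  · intro t ht j hj
    rcases Nat.lt_succ_iff_lt_or_eq.1 ht with ht | rfl
    · rw [hyt t ht.ne]; exact h.own t ht j hj
    · rw [hyn]
      simp only [v, hj, if_true]
  · intro t ht j hj hne
    have : ∃ b, ∀ s ∈ g j, s < n ∧ lab A x s = b := by
      rcases Nat.lt_succ_iff_lt_or_eq.1 ht with ht | rfl
      · rw [hyt t ht.ne] at hne; exact h.full t ht j hj hne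
      · rw [hyn] at hne
        simp only [v, hj, if_false] at hne
        by_contra hcon
        rw [if_neg hcon] at hne
        exact hne rfl
    obtain ⟨b, hb⟩ := this
    exact ⟨b, fun s hs => ⟨(hb s hs).1.trans n.lt_succ_self,
      (hlab s (hb s hs).1).trans (hb s hs).2⟩⟩
  · intro b
    rw [range_add_one, filter_insert]
    split_ifs with hb
    · rw [card_insert_of_notMem (by simp), hfilter]
      -- If the bin already held `B` items, their set would own a coordinate `j` with load exactly
      -- `B`, and the new item adds `1/(N+1)` there.
      by_contra hlt
      obtain ⟨S, hS, hcard⟩ := exists_subset_card_eq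
        (by omega : B ≤ #{t ∈ range n | lab A x t = b})
      have hSn : ∀ s ∈ S, s < n ∧ lab A x s = b := fun s hs => by simpa using hS hs
      obtain ⟨j, hj⟩ := hg S (mem_powersetCard.2
        ⟨fun s hs => mem_range.2 ((hSn s hs).1.trans hn), hcard⟩)
      have hnS : n ∉ S := fun hs => (hSn n hs).1.false
      have hsum := (hA.feasible (n := n + 1) fun i _ => hy i).sum_le (fun i _ => hy i)
        (b := b) (T := insert n S) (by
          intro i hi
          rcases mem_insert.1 hi with rfl | hi
          · exact ⟨i.lt_succ_self, hb⟩
          · exact ⟨(hSn i hi).1.trans n.lt_succ_self, (hlab i (hSn i hi).1).trans (hSn i hi).2⟩) j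
      rw [sum_insert hnS, hyn] at hsum
      have h1 : v j = 1 / (N + 1) := by
        have : n ∉ g j := by rwa [hj]
        simp only [v, this, if_false]
        rw [if_pos ⟨b, by rwa [hj]⟩]
      have h2 : ∑ i ∈ S, y i j = B := by
        rw [← hcard, card_eq_sum_ones, Nat.cast_sum]
        refine sum_congr rfl fun i hi => ?_
        rw [hyt i (hSn i hi).1.ne, h.own i (hSn i hi).1 j (hj ▸ hi), Nat.cast_one]
      linarith
    · rw [hfilter]
      exact h.card_le b

lemma FullBinGame.exists {A : OnlineRule d} {B N : ℕ} (hA : IsOnlineAlgorithm B A)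
    {g : Fin d → Finset ℕ} (hg : ∀ S ∈ powersetCard B (range N), ∃ j, g j = S) :
    ∀ n ≤ N, ∃ x, FullBinGame A B N g x n := by
  intro n
  induction n with
  | zero => exact fun _ => ⟨fun _ _ => 0, by simp, by simp, by simp, by simp, by simp⟩
  | succ n ih =>
    intro hn
    obtain ⟨x, hx⟩ := ih (by omega)
    exact hx.step hA hg hn

/-- Colour the first item of every bin `0` and all others `1`. -/
noncomputable def laterColor (A : OnlineRule d) (x : ℕ → Item d) (t : ℕ) : ℕ :=
  open Classical in if ∃ s < t, lab A x s = lab A x t then 1 else 0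

/-- A full bin is not monochromatic. -/
lemma exists_laterColor_ne {A : OnlineRule d} {x : ℕ → Item d} {n b : ℕ} {S : Finset ℕ}
    (hS : S = {t ∈ range n | lab A x t = b}) (h2 : 2 ≤ #S) (γ : ℕ) :
    ∃ s ∈ S, laterColor A x s ≠ γ := by
  classical
  have hmem : ∀ s, s ∈ S ↔ s < n ∧ lab A x s = b := fun s => by simp [hS]
  have hne : S.Nonempty := card_pos.1 (by omega)
  have hmin := S.min'_mem hne
  by_cases hγ : γ = 0
  · obtain ⟨t, ht, htne⟩ := exists_mem_ne (by omega : 1 < #S) (S.min' hne)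
    refine ⟨t, ht, ?_⟩
    have : ∃ s < t, lab A x s = lab A x t :=
      ⟨S.min' hne, lt_of_le_of_ne (S.min'_le t ht) htne.symm,
        ((hmem _).1 hmin).2.trans ((hmem _).1 ht).2.symm⟩
    rw [laterColor, if_pos this, hγ]
    exact one_ne_zero
  · refine ⟨S.min' hne, hmin, ?_⟩
    rw [laterColor, if_neg]
    · exact fun h => hγ h.symm
    · rintro ⟨s, hs, hlab⟩
      have : s ∈ S := (hmem s).2 ⟨hs.trans ((hmem _).1 hmin).1, hlab.trans ((hmem _).1 hmin).2⟩
      exact absurd (S.min'_le s this) (not_le.2 hs)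

/-- On an uncharged coordinate only its `B` owners are nonzero. On a charged one the owners have
both colours, so each class has at most `B - 1` ones, and at most `N` entries `1/(N+1)` fill less
than the last unit. -/
lemma FullBinGame.feasible {A : OnlineRule d} {B N : ℕ} (hB : 2 ≤ B) {g : Fin d → Finset ℕ}
    (hg : ∀ j, #(g j) = B) {x : ℕ → Item d} (h : FullBinGame A B N g x N) :
    Feasible B x N (laterColor A x) := by
  classical
  intro γ j
  set T := {i ∈ range N | laterColor A x i = γ} with hT
  have hTN : ∀ t ∈ T, t < N := fun t ht => mem_range.1 (mem_filter.1 ht).1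
  rw [← sum_filter_add_sum_filter_not T (fun t => t ∈ g j)]
  have hown : ∑ t ∈ T with t ∈ g j, x t j = (#{t ∈ T | t ∈ g j} : ℝ) := by
    rw [card_eq_sum_ones, Nat.cast_sum]
    refine sum_congr rfl fun t ht => ?_
    rw [mem_filter] at ht
    rw [h.own t (hTN t ht.1) j ht.2, Nat.cast_one]
  rw [hown]
  by_cases hzero : ∀ t ∈ T, t ∉ g j → x t j = 0
  · have h0 : ∑ t ∈ T with t ∉ g j, x t j = 0 := sum_eq_zero fun t ht => by
      rw [mem_filter] at ht; exact hzero t ht.1 ht.2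
    rw [h0, add_zero, ← hg j]
    exact_mod_cast card_le_card fun t ht => (mem_filter.1 ht).2
  · push Not at hzero
    obtain ⟨t, ht, htj, hne⟩ := hzero
    obtain ⟨b, hb⟩ := h.full t (hTN t ht) j htj hne
    -- The `B` owners lie in one bin and no bin holds more than `B` items, so they are the whole
    -- bin.
    have hS : g j = {t ∈ range N | lab A x t = b} :=
      eq_of_subset_of_card_le (fun s hs => by simpa using hb s hs) (by rw [hg]; exact h.card_le b)
    obtain ⟨s, hs, hsγ⟩ := exists_laterColor_ne hS (by rw [hg]; exact hB) γ
    have hlt : #{t ∈ T | t ∈ g j} + 1 ≤ B := by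
      rw [← hg j]
      refine card_lt_card ⟨fun t ht => (mem_filter.1 ht).2, fun hsub => hsγ ?_⟩
      exact (mem_filter.1 (mem_filter.1 (hsub hs)).1).2
    have hlt' : (#{t ∈ T | t ∈ g j} : ℝ) + 1 ≤ B := by exact_mod_cast hlt
    have hsmall : ∑ t ∈ T with t ∉ g j, x t j ≤ 1 := by
      calc ∑ t ∈ T with t ∉ g j, x t j ≤ ∑ t ∈ T with t ∉ g j, 1 / (N + 1 : ℝ) :=
            sum_le_sum fun t ht => by
              rw [mem_filter] at ht; exact h.small t (hTN t ht.1) j ht.2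
        _ = #{t ∈ T | t ∉ g j} * (1 / (N + 1 : ℝ)) := by rw [sum_const, nsmul_eq_mul]
        _ ≤ N * (1 / (N + 1 : ℝ)) := by
            gcongr
            calc #{t ∈ T | t ∉ g j} ≤ #(range N) :=
                  card_le_card ((filter_subset _ _).trans (filter_subset _ _))
              _ = N := card_range N
        _ ≤ 1 := by
            rw [mul_one_div, div_le_one (by positivity)]
            linarith
    linarith

lemma le_choose_add (B i : ℕ) (hB : 1 ≤ B) : i + 1 ≤ (B + i).choose B := by
  induction i with
  | zero => simp
  | succ i ih =>
    obtain ⟨B, rfl⟩ := Nat.exists_eq_add_of_le' hB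
    rw [← add_assoc, Nat.choose_succ_succ']
    have : 0 < (B + 1 + i).choose B := Nat.choose_pos (by omega)
    omega

/-- The largest `N` with `N.choose B ≤ d`. -/
lemma exists_choose_le_lt {B : ℕ} (hB : 1 ≤ B) (hd : 1 ≤ d) :
    ∃ N, B ≤ N ∧ N.choose B ≤ d ∧ d < (N + 1).choose B := by
  classical
  have hex : ∃ M : ℕ, d < M.choose B := ⟨B + d, le_choose_add B d hB⟩
  have hspec := Nat.find_spec hex
  have hgt : B < Nat.find hex := by
    by_contra hle
    have := Nat.choose_le_choose B (not_lt.1 hle)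
    rw [Nat.choose_self] at this
    omega
  obtain ⟨N, hN⟩ := Nat.exists_eq_add_of_lt hgt
  refine ⟨B + N, Nat.le_add_right _ _, not_lt.1 (Nat.find_min hex (by omega)), ?_⟩
  rwa [← hN]

/-- `B!` times the binomial coefficient is a descending factorial, hence at most `(N+1)^B`. -/
lemma rpow_factorial_mul_lt {B N : ℕ} (hB : 1 ≤ B) (h : d < (N + 1).choose B) :
    ((B.factorial : ℝ) * d) ^ ((1 : ℝ) / B) < N + 1 := by
  have h1 : B.factorial * d < (N + 1) ^ B :=
    calc B.factorial * d < B.factorial * (N + 1).choose B :=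
          Nat.mul_lt_mul_of_pos_left h (Nat.factorial_pos B)
      _ = (N + 1).descFactorial B := (Nat.descFactorial_eq_factorial_mul_choose _ _).symm
      _ ≤ (N + 1) ^ B := Nat.descFactorial_le_pow _ _
  have h2 : (B.factorial : ℝ) * d < (N + 1 : ℝ) ^ B := by exact_mod_cast h1
  calc ((B.factorial : ℝ) * d) ^ ((1 : ℝ) / B) < ((N + 1 : ℝ) ^ B) ^ ((1 : ℝ) / B) :=
        Real.rpow_lt_rpow (by positivity) h2 (by positivity)
    _ = N + 1 := by
        rw [one_div, Real.pow_rpow_inv_natCast (by positivity) (by omega)]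

theorem lower_bound_of_two_le (hd : 1 ≤ d) {B : ℕ} (hB : 2 ≤ B) {A : OnlineRule d}
    (hA : IsOnlineAlgorithm B A) :
    ∃ I : List (Item d), IsInstance I ∧ opt B I = 2 ∧
      (((B.factorial : ℝ) * (d : ℝ)) ^ ((1 : ℝ) / (B : ℝ)) - 1) / (2 * (B : ℝ)) < ratio B A I := by
  classical
  obtain ⟨N, hBN, hN, hlt⟩ := exists_choose_le_lt (d := d) (by omega : 1 ≤ B) hd
  have hcard : Fintype.card (powersetCard B (range N)) ≤ Fintype.card (Fin d) := by simpa using hN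
  have hne : Nonempty (powersetCard B (range N)) := by
    obtain ⟨S, hS⟩ := powersetCard_nonempty.2 (by simpa using hBN : B ≤ #(range N))
    exact ⟨⟨S, hS⟩⟩
  obtain ⟨e⟩ := Function.Embedding.nonempty_of_card_le hcard
  -- Surplus coordinates get the default value of `invFun`, again a `B`-set; such repetitions are
  -- harmless.
  let f := Function.invFun e
  have hf : Function.LeftInverse f e := Function.leftInverse_invFun e.injective
  obtain ⟨x, hx⟩ := FullBinGame.exists hA (g := fun j => (f j : Finset ℕ))
    (fun S hS => ⟨e ⟨S, hS⟩, by rw [hf]⟩) N le_rfl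
  have hfe := hx.feasible hB fun j => (mem_powersetCard.1 (f j).2).2
  obtain ⟨I, hI, hopt, hr⟩ := exists_ratio_of_opt_le_two (by omega : 1 ≤ B) hd A
    (fun i _ => hx.mem_Icc i)
    (opt_seq_le_of_lt hfe fun i _ => by rw [laterColor]; split_ifs <;> omega) le_rfl
  refine ⟨I, hI, hopt, lt_of_lt_of_le ?_ hr⟩
  have hbins : N ≤ B * #((range N).image (lab A x)) := by
    simpa using card_le_mul_card_image (range N) B fun b _ => hx.card_le b
  have hbins' : (N : ℝ) ≤ B * #((range N).image (lab A x)) := by exact_mod_cast hbins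
  have hroot := rpow_factorial_mul_lt (by omega : 1 ≤ B) hlt
  have hB0 : (0 : ℝ) < B := by exact_mod_cast (by omega : 0 < B)
  rw [div_lt_div_iff₀ (by positivity) two_pos]
  linarith

/-! ### Bin size one: the colouring adversary -/

/-- The invariant of the colouring adversary for bin size one: the coordinate `t` belongs to the
`t`-th item and is charged by later items that must not get its colour. -/
structure ColorGame (A : OnlineRule d) (k m : ℕ) (x : ℕ → Item d) (c : ℕ → Fin k) (n : ℕ) :
    Prop where
  mem_Icc : ∀ t j, x t j ∈ Set.Icc (0 : ℝ) 1
  small : ∀ t < n, ∀ j : Fin d, (j : ℕ) ≠ t → x t j ≤ 1 / (d + 1)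
  own : ∀ t < n, ∀ j : Fin d, (j : ℕ) = t → x t j = 1
  color : ∀ t < n, ∀ j : Fin d, (j : ℕ) < n → (j : ℕ) ≠ t → c j = c t → x t j = 0
  inj : ∀ s < n, ∀ t < n, lab A x s = lab A x t → c s = c t → s = t
  card_le : ∀ b, #{t ∈ range n | lab A x t = b} ≤ m
  later : ∀ t < n, ∀ j : Fin d, t < (j : ℕ) → x t j = 0

lemma ColorGame.step {A : OnlineRule d} {k m : ℕ} (hA : IsOnlineAlgorithm 1 A)
    {F : Finset (Finset (Fin k))} (hF : ∀ S ∈ F, S.Nonempty ∧ #S ≤ m)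
    {x : ℕ → Item d} {c : ℕ → Fin k} {n : ℕ} (hn : n < d + 1) (h : ColorGame A k m x c n)
    (hbins : #((range n).image (lab A x)) < #F) :
    ∃ y c', ColorGame A k m y c' (n + 1) := by
  classical
  have hε : (0 : ℝ) < 1 / (d + 1) := by positivity
  have hε1 : 1 / (d + 1 : ℝ) ≤ 1 := by
    rw [div_le_one (by positivity)]
    linarith [(Nat.cast_nonneg d : (0 : ℝ) ≤ d)]
  let hue : ℕ → Finset (Fin k) := fun b => {t ∈ range n | lab A x t = b}.image c
  obtain ⟨S, hSF, hS⟩ := exists_mem_notMem_of_card_lt_card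
    (card_image_le.trans_lt hbins : #(((range n).image (lab A x)).image hue) < #F)
  obtain ⟨hSne, hSm⟩ := hF S hSF
  -- The last item, `n = d`, owns no coordinate. Coordinates with colours in `S` get 0, so whichever
  -- colour of `S` is chosen later, the item does not disturb its own class.
  let v : Item d := fun j => if (j : ℕ) = n then 1 else
    if (j : ℕ) < n ∧ c j ∉ S then 1 / (d + 1) else 0
  have hv : ∀ j, v j ∈ Set.Icc (0 : ℝ) 1 := by
    intro j
    simp only [v, Set.mem_Icc]
    split_ifs <;> constructor <;> linarith
  let y := Function.update x n v
  have hyn : y n = v := Function.update_self _ _ _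
  have hyt : ∀ t, t ≠ n → y t = x t := fun t ht => Function.update_of_ne ht _ _
  have hlab : ∀ t < n, lab A y t = lab A x t := fun t ht => lab_update A x ht v
  have hy : ∀ t j, y t j ∈ Set.Icc (0 : ℝ) 1 := by
    intro t j
    by_cases ht : t = n
    · rw [ht, hyn]; exact hv j
    · rw [hyt t ht]; exact h.mem_Icc t j
  have hfilter : ∀ b, {t ∈ range n | lab A y t = b} = {t ∈ range n | lab A x t = b} := fun b =>
    filter_congr fun t ht => by rw [hlab t (mem_range.1 ht)]
  set b := lab A y n with hb
  have hbS : ∀ s < n, lab A x s = b → c s ∈ S := by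
    intro s hs hsb
    by_contra hcS
    have hsum := (hA.feasible (n := n + 1) fun i _ => hy i).sum_le (fun i _ => hy i)
      (b := b) (T := {s, n}) (by
        intro i hi
        rcases mem_insert.1 hi with rfl | hi
        · exact ⟨by omega, (hlab i hs).trans hsb⟩
        · rw [mem_singleton] at hi
          subst hi
          exact ⟨by omega, rfl⟩) ⟨s, by omega⟩
    rw [sum_pair hs.ne, hyn, hyt s hs.ne, h.own s hs _ rfl] at hsum
    have : v ⟨s, by omega⟩ = 1 / (d + 1) := by
      simp only [v, hs.ne, if_false, hs, hcS, not_false_eq_true, and_self, if_true]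
    rw [this] at hsum
    push_cast at hsum
    linarith
  have hsub : hue b ⊆ S := by
    intro γ hγ
    obtain ⟨t, ht, rfl⟩ := mem_image.1 hγ
    simp only [mem_filter, mem_range] at ht
    exact hbS t ht.1 ht.2
  -- An opened bin is excluded by the choice of `S`; a new bin has no colours, whereas `S` is
  -- nonempty.
  have hne : hue b ≠ S := by
    intro heq
    obtain ⟨γ, hγ⟩ := hSne
    rw [← heq] at hγ
    obtain ⟨t, ht, -⟩ := mem_image.1 hγ
    simp only [mem_filter, mem_range] at ht
    exact hS (mem_image.2 ⟨b, mem_image.2 ⟨t, mem_range.2 ht.1, ht.2⟩, heq⟩)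
  obtain ⟨γ, hγS, hγ⟩ := exists_of_ssubset (hsub.ssubset_of_ne hne)
  let c' := Function.update c n γ
  have hcn : c' n = γ := Function.update_self _ _ _
  have hct : ∀ t, t ≠ n → c' t = c t := fun t ht => Function.update_of_ne ht _ _
  have hnew : ∀ s < n, lab A y s = b → c' s ≠ γ := by
    intro s hs hsb hsγ
    rw [hct s hs.ne] at hsγ
    exact hγ (mem_image.2 ⟨s, by simp [hs, ← hlab s hs, hsb], hsγ⟩)
  refine ⟨y, c', hy, ?_, ?_, ?_, ?_, ?_, ?_⟩
  · intro t ht j hj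
    rcases Nat.lt_succ_iff_lt_or_eq.1 ht with ht | rfl
    · rw [hyt t ht.ne]; exact h.small t ht j hj
    · rw [hyn]
      simp only [v, hj, if_false]
      split_ifs
      · exact le_rfl
      · exact hε.le
  · intro t ht j hj
    rcases Nat.lt_succ_iff_lt_or_eq.1 ht with ht | rfl
    · rw [hyt t ht.ne]; exact h.own t ht j hj
    · rw [hyn]
      simp only [v, hj, if_true]
  · intro t ht j hjn hjt hcol
    rcases Nat.lt_succ_iff_lt_or_eq.1 ht with ht | rfl
    · rw [hyt t ht.ne]
      by_cases hj : (j : ℕ) = n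
      -- Coordinate `n` receives its colour only now; earlier items cannot clash with it because
      -- they vanish there.
      · exact h.later t ht j (by omega)
      · rw [hct t ht.ne, hct _ hj] at hcol
        exact h.color t ht j (by omega) hjt hcol
    · rw [hyn]
      rw [hcn, hct _ hjt] at hcol
      simp only [v, hjt, if_false, hcol, hγS, not_true_eq_false, and_false]
  · intro s hs t ht hst hcst
    rcases Nat.lt_succ_iff_lt_or_eq.1 hs with hs | rfl <;>
      rcases Nat.lt_succ_iff_lt_or_eq.1 ht with ht | rfl
    · rw [hlab s hs, hlab t ht] at hst
      rw [hct s hs.ne, hct t ht.ne] at hcst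
      exact h.inj s hs t ht hst hcst
    · exact absurd (hcst.trans hcn) (hnew s hs hst)
    · exact absurd (hcst.symm.trans hcn) (hnew t ht hst.symm)
    · rfl
  · intro b'
    rw [range_add_one, filter_insert]
    split_ifs with hbb
    · rw [card_insert_of_notMem (by simp), hfilter]
      -- The bin is rainbow, so its size before this item is its number of colours, less than `#S ≤
      -- m`.
      have hinj : Set.InjOn c ({t ∈ range n | lab A x t = b'} : Finset ℕ) := by
        intro s hs t ht hst
        simp only [coe_filter, mem_range, Set.mem_ofPred_eq] at hs ht
        exact h.inj s hs.1 t ht.1 (hs.2.trans ht.2.symm) hst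
      have := card_image_of_injOn hinj
      have h2 := card_lt_card (hsub.ssubset_of_ne hne)
      rw [← hbb, ← hb] at this ⊢
      simp only [hue] at h2
      omega
    · rw [hfilter]
      exact h.card_le b'
  · intro t ht j hj
    rcases Nat.lt_succ_iff_lt_or_eq.1 ht with ht | rfl
    · rw [hyt t ht.ne]; exact h.later t ht j hj
    · rw [hyn]
      simp only [v, hj.ne', if_false, hj.not_gt, false_and]

/-- If coordinate `j` has the colour of the class, only item `j` is nonzero there; otherwise the
class has at most `d + 1` entries, each at most `1/(d+1)`. -/
lemma ColorGame.feasible {A : OnlineRule d} {k m n : ℕ} {x : ℕ → Item d} {c : ℕ → Fin k}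
    (hn : n ≤ d + 1) (h : ColorGame A k m x c n) : Feasible 1 x n (fun t => c t) := by
  intro γ j
  by_cases hj : (j : ℕ) < n ∧ (c j : ℕ) = γ
  · rw [sum_eq_single_of_mem (j : ℕ) (by simpa using hj)]
    · simpa using (h.mem_Icc j j).2
    · intro t ht htj
      simp only [mem_filter, mem_range] at ht
      exact h.color t ht.1 j hj.1 htj.symm (Fin.ext (hj.2.trans ht.2.symm))
  · calc ∑ t ∈ range n with (c t : ℕ) = γ, x t j
        ≤ ∑ t ∈ range n with (c t : ℕ) = γ, 1 / (d + 1 : ℝ) := sum_le_sum fun t ht => by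
          simp only [mem_filter, mem_range] at ht
          refine h.small t ht.1 j ?_
          rintro rfl
          exact hj ht
      _ = #{t ∈ range n | (c t : ℕ) = γ} * (1 / (d + 1 : ℝ)) := by rw [sum_const, nsmul_eq_mul]
      _ ≤ (d + 1 : ℕ) * (1 / (d + 1 : ℝ)) := by
          gcongr
          exact (card_le_card (filter_subset _ _)).trans (by simpa using hn)
      _ = (1 : ℕ) := by
          push_cast
          field_simp

/-- Let `F` be a family of nonempty colour sets of size at most `m`. Every online algorithm can be
made to open `|F|` bins, or `(d + 1) / m` bins, on a `k`-colourable instance. -/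
theorem exists_opt_le_of_family {A : OnlineRule d} {k m : ℕ} (hA : IsOnlineAlgorithm 1 A)
    {F : Finset (Finset (Fin k))} (hF : ∀ S ∈ F, S.Nonempty ∧ #S ≤ m) (hne : F.Nonempty) :
    ∃ I : List (Item d), IsInstance I ∧ 0 < opt 1 I ∧ opt 1 I ≤ k ∧
      (d + 1 ≤ m * numBins (run A I) ∨ #F ≤ numBins (run A I)) := by
  classical
  obtain ⟨S, hS⟩ := hne
  obtain ⟨γ, -⟩ := (hF S hS).1
  -- The game freezes as soon as `#F` bins are open, since then a missing colour set need not exist.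
  have key : ∀ n ≤ d + 1, ∃ n' x c, ColorGame A k m x c n' ∧ n' ≤ d + 1 ∧
      (n' = n ∨ #F ≤ #((range n').image (lab A x))) := by
    intro n
    induction n with
    | zero =>
      exact fun _ => ⟨0, fun _ _ => 0, fun _ => γ, ⟨by simp, by simp, by simp, by simp, by simp,
        by simp, by simp⟩, by omega, Or.inl rfl⟩
    | succ n ih =>
      intro hn
      obtain ⟨n', x, c, hx, hn', h⟩ := ih (by omega)
      by_cases hbins : #F ≤ #((range n').image (lab A x))
      · exact ⟨n', x, c, hx, hn', Or.inr hbins⟩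
      · obtain rfl := h.resolve_right hbins
        obtain ⟨y, c', hy⟩ := hx.step hA hF (by omega) (not_le.1 hbins)
        exact ⟨n' + 1, y, c', hy, hn, Or.inl rfl⟩
  obtain ⟨n, x, c, hx, hn, h⟩ := key (d + 1) le_rfl
  have hpos : 0 < n := by
    rcases h with h | h
    · omega
    · rcases Nat.eq_zero_or_pos n with rfl | hn0
      · simp at h
        simp [h] at hS
      · exact hn0
  refine ⟨seq x n, isInstance_seq.2 fun i _ => hx.mem_Icc i,
    opt_seq_pos le_rfl hpos fun i _ => hx.mem_Icc i,
    opt_seq_le_of_lt (hx.feasible hn) fun i _ => (c i).2, ?_⟩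
  rw [numBins_run]
  refine h.imp_left ?_
  rintro rfl
  simpa using card_le_mul_card_image (range (d + 1)) m fun b _ => hx.card_le b

/-! ### Counting colour sets; dimensions at least 16 -/

/-- The nonempty sets of at most `m` colours. -/
def smallSets (k m : ℕ) : Finset (Finset (Fin k)) := {S | S ≠ ∅ ∧ #S ≤ m}

/-- Complementation sends the sets with more than `k / 2` colours injectively to the others; the
extra 1 is the empty set. -/
lemma two_pow_le_card_smallSets (k : ℕ) : 2 ^ k ≤ 2 * (#(smallSets k (k / 2)) + 1) := by
  classical
  have h1 : #{S : Finset (Fin k) | #S ≤ k / 2} ≤ #(smallSets k (k / 2)) + 1 := by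
    refine (card_le_card (t := insert ∅ (smallSets k (k / 2))) ?_).trans (card_insert_le _ _)
    intro S hS
    by_cases h0 : S = ∅
    · simp [h0]
    · simpa [smallSets, h0] using hS
  have h2 : #{S : Finset (Fin k) | ¬ #S ≤ k / 2} ≤ #{S : Finset (Fin k) | #S ≤ k / 2} := by
    refine card_le_card_of_injOn compl ?_ (compl_injective.injOn)
    intro S hS
    simp only [coe_filter, mem_univ, true_and, Set.mem_ofPred_eq, card_compl,
      Fintype.card_fin] at hS ⊢
    omega
  have h3 := card_filter_add_card_filter_not (s := (univ : Finset (Finset (Fin k))))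
    (fun S => #S ≤ k / 2)
  rw [card_univ, Fintype.card_finset, Fintype.card_fin] at h3
  omega

theorem exists_ratio_of_smallSets {A : OnlineRule d} {k m : ℕ} (hA : IsOnlineAlgorithm 1 A)
    {r L : ℝ} (hL : (k : ℝ) ≤ L) (hS : r * k < #(smallSets k m))
    (hr : 0 ≤ r) (hn : ∀ b : ℕ, d + 1 ≤ m * b → r * k < b) :
    ∃ I : List (Item d), IsInstance I ∧ (opt 1 I : ℝ) ≤ L ∧ r < ratio 1 A I := by
  have hpos : 0 < #(smallSets k m) := by
    have : (0 : ℝ) < #(smallSets k m) := lt_of_le_of_lt (by positivity) hS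
    exact_mod_cast this
  obtain ⟨I, hI, hpos, hopt, h⟩ := exists_opt_le_of_family hA (F := smallSets k m)
    (fun S hS => by simpa [smallSets, nonempty_iff_ne_empty] using hS) (card_pos.1 hpos)
  have hoptk : (opt 1 I : ℝ) ≤ k := by exact_mod_cast hopt
  refine ⟨I, hI, hoptk.trans hL, ?_⟩
  have hpos' : (0 : ℝ) < opt 1 I := by exact_mod_cast hpos
  rw [ratio, lt_div_iff₀ hpos']
  have : r * k < numBins (run A I) := by
    rcases h with h | h
    · exact hn _ h
    · exact hS.trans_le (by exact_mod_cast h)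
  nlinarith

/-- `log₂` lies above its chord between two consecutive powers of two. -/
lemma le_logb_two {k : ℕ} (h1 : 2 ^ k ≤ d) (h2 : d ≤ 2 ^ (k + 1)) :
    (k : ℝ) - 1 + d / 2 ^ k ≤ Real.logb 2 d := by
  have hk : (0 : ℝ) < 2 ^ k := by positivity
  have h1' : (2 : ℝ) ^ k ≤ d := by exact_mod_cast h1
  have h2' : (d : ℝ) ≤ 2 ^ (k + 1) := by exact_mod_cast h2
  have hd : (0 : ℝ) < d := hk.trans_le h1'
  have hy1 : 1 ≤ (d : ℝ) / 2 ^ k := by rwa [le_div_iff₀ hk, one_mul]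
  have hy2 : (d : ℝ) / 2 ^ k ≤ 2 := by rwa [div_le_iff₀ hk, ← pow_succ']
  rw [Real.le_logb_iff_rpow_le one_lt_two hd]
  -- Bernoulli with exponent in `[0,1]`: for `y = d / 2^k` it gives `2^(y-1) ≤ y`.
  have hb := rpow_one_add_le_one_add_mul_self (s := 1) (by norm_num)
    (p := (d : ℝ) / 2 ^ k - 1) (by linarith) (by linarith)
  calc (2 : ℝ) ^ ((k : ℝ) - 1 + d / 2 ^ k) = 2 ^ k * (1 + 1 : ℝ) ^ ((d : ℝ) / 2 ^ k - 1) := by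
        rw [one_add_one_eq_two, ← Real.rpow_natCast, ← Real.rpow_add two_pos]
        congr 1
        ring
    _ ≤ 2 ^ k * (1 + (d / 2 ^ k - 1) * 1) := by gcongr
    _ = d := by field_simp; ring

/-- The conclusion of the lower bound for bin size one. -/
def HasBadInstance (A : OnlineRule d) : Prop :=
  ∃ I : List (Item d), IsInstance I ∧ (opt 1 I : ℝ) ≤ Real.logb 2 d ∧
    2 * (d : ℝ) / (Real.logb 2 d) ^ 2 < ratio 1 A I

/-- A lower bound `L` replaces the logarithm, so that the two conditions become polynomial. The
second holds once `L ^ 2 ≥ 2 * k * m`; for `k = 4` this means 16, 24, 32 for `m = 2, 3, 4`, which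
guides the case splits below. -/
lemma hasBadInstance_of_smallSets {A : OnlineRule d} (hA : IsOnlineAlgorithm 1 A) {k m : ℕ}
    {L : ℝ} (hL0 : 0 < L) (hL : L ≤ Real.logb 2 d) (hk : (k : ℝ) ≤ Real.logb 2 d)
    (hS : 2 * (d : ℝ) * k < #(smallSets k m) * L ^ 2)
    (hn : ∀ b : ℕ, d + 1 ≤ m * b → 2 * (d : ℝ) * k < b * L ^ 2) : HasBadInstance A := by
  have hsq : L ^ 2 ≤ Real.logb 2 d ^ 2 := by gcongr
  have hpos : 0 < Real.logb 2 d ^ 2 := (by positivity : 0 < L ^ 2).trans_le hsq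
  refine exists_ratio_of_smallSets hA (m := m) hk ?_ (by positivity) fun b hb => ?_
  · rw [div_mul_eq_mul_div, div_lt_iff₀ hpos]
    exact hS.trans_le (by gcongr)
  · rw [div_mul_eq_mul_div, div_lt_iff₀ hpos]
    exact (hn b hb).trans_le (by gcongr)

lemma card_smallSets_four_two : #(smallSets 4 2) = 10 := by decide
lemma card_smallSets_four_three : #(smallSets 4 3) = 14 := by decide
lemma card_smallSets_four_four : #(smallSets 4 4) = 15 := by decide
lemma card_smallSets_six_three : #(smallSets 6 3) = 41 := by decide +kernel

lemma hasBadInstance_of_mem_sixteen {A : OnlineRule d} (hA : IsOnlineAlgorithm 1 A)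
    (h1 : 16 ≤ d) (h2 : d < 32) : HasBadInstance A := by
  have hL := le_logb_two (d := d) (k := 4) (by omega) (by omega)
  have h1' : (16 : ℝ) ≤ d := by exact_mod_cast h1
  norm_num at hL
  by_cases h : d ≤ 28
  · have h' : (d : ℝ) ≤ 28 := by exact_mod_cast h
    refine hasBadInstance_of_smallSets hA (k := 4) (m := 2) (by positivity) hL
      (by push_cast; linarith) ?_ fun b hb => ?_
    · rw [card_smallSets_four_two]
      push_cast
      nlinarith
    · have hb' : (d : ℝ) + 1 ≤ 2 * b := by exact_mod_cast hb
      push_cast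
      have : (16 : ℝ) ≤ (3 + d / 16) ^ 2 := by nlinarith
      nlinarith
  -- At `d = 29` the chord bound `77/16` is slightly too weak for ten bins; `29/6` works because
  -- `2^29 ≤ 29^6`.
  · have hL' : (29 / 6 : ℝ) ≤ Real.logb 2 d := by
      have h29 : (29 : ℝ) ≤ d := by exact_mod_cast (by omega : 29 ≤ d)
      rw [Real.le_logb_iff_rpow_le one_lt_two (by linarith)]
      refine le_trans ?_ h29
      rw [← Real.rpow_le_rpow_iff (z := 6) (by positivity) (by norm_num) (by norm_num),
        ← Real.rpow_mul (by norm_num)]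
      norm_num
    refine hasBadInstance_of_smallSets hA (k := 4) (m := 3) (by norm_num) hL'
      (by push_cast; linarith) ?_ fun b hb => ?_
    · rw [card_smallSets_four_three]
      have : (d : ℝ) ≤ 31 := by exact_mod_cast (by omega : d ≤ 31)
      push_cast
      linarith
    · rcases (by omega : d = 29 ∧ 10 ≤ b ∨ d ≤ 31 ∧ 11 ≤ b) with ⟨hd, hb⟩ | ⟨hd, hb⟩
      · have hd' : (d : ℝ) = 29 := by exact_mod_cast hd
        have hb' : (10 : ℝ) ≤ b := by exact_mod_cast hb
        push_cast
        linarith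
      · have hd' : (d : ℝ) ≤ 31 := by exact_mod_cast hd
        have hb' : (11 : ℝ) ≤ b := by exact_mod_cast hb
        push_cast
        linarith

lemma hasBadInstance_of_mem_thirtyTwo {A : OnlineRule d} (hA : IsOnlineAlgorithm 1 A)
    (h1 : 32 ≤ d) (h2 : d < 64) : HasBadInstance A := by
  have hL := le_logb_two (d := d) (k := 5) (by omega) (by omega)
  have h1' : (32 : ℝ) ≤ d := by exact_mod_cast h1
  norm_num at hL
  by_cases h : d ≤ 53
  · have h' : (d : ℝ) ≤ 53 := by exact_mod_cast h
    refine hasBadInstance_of_smallSets hA (k := 4) (m := 3) (by positivity) hL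
      (by push_cast; linarith) ?_ fun b hb => ?_
    · rw [card_smallSets_four_three]
      push_cast
      nlinarith
    · have hb' : (d : ℝ) + 1 ≤ 3 * b := by exact_mod_cast hb
      push_cast
      have : (24 : ℝ) ≤ (4 + d / 32) ^ 2 := by nlinarith
      nlinarith
  · have h' : (54 : ℝ) ≤ d := by exact_mod_cast (by omega : 54 ≤ d)
    have h'' : (d : ℝ) ≤ 63 := by exact_mod_cast (by omega : d ≤ 63)
    refine hasBadInstance_of_smallSets hA (k := 4) (m := 4) (by positivity) hL
      (by push_cast; linarith) ?_ fun b hb => ?_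
    · rw [card_smallSets_four_four]
      push_cast
      nlinarith
    · have hb' : (d : ℝ) + 1 ≤ 4 * b := by exact_mod_cast hb
      push_cast
      have : (32 : ℝ) ≤ (4 + d / 32) ^ 2 := by nlinarith
      nlinarith

/-- This is the condition on the number of colour sets at the extreme `d = 2^(k+1)`, where the
logarithm is `k + 1`. The complement count just fails at `k = 6`, hence the exact value 41. -/
lemma sq_mul_pow_le {k : ℕ} (hk : 6 ≤ k) :
    (k : ℝ) * 2 ^ (k + 2) ≤ (k + 1) ^ 2 * #(smallSets k (k / 2)) := by
  rcases hk.eq_or_lt with rfl | hk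
  · rw [card_smallSets_six_three]
    norm_num
  · have h : (2 : ℝ) ^ k ≤ 2 * (#(smallSets k (k / 2)) + 1) := by
      exact_mod_cast two_pow_le_card_smallSets k
    have hk' : (7 : ℝ) ≤ k := by exact_mod_cast hk
    have h128 : (128 : ℝ) ≤ 2 ^ k :=
      calc (128 : ℝ) = 2 ^ 7 := by norm_num
        _ ≤ 2 ^ k := pow_le_pow_right₀ one_le_two hk
    have h3 : (0 : ℝ) ≤ (k + 1) ^ 2 - 8 * k := by nlinarith
    have h4 := mul_le_mul_of_nonneg_left h128 h3
    have h5 : (0 : ℝ) ≤ (k + 1) ^ 2 := by positivity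
    rw [pow_add]
    nlinarith

lemma hasBadInstance_of_le_sixtyFour {A : OnlineRule d} (hA : IsOnlineAlgorithm 1 A)
    (h : 64 ≤ d) : HasBadInstance A := by
  set k := Nat.log 2 d with hk
  have hd0 : d ≠ 0 := by omega
  have h1 : 2 ^ k ≤ d := Nat.pow_log_le_self 2 hd0
  have h2 : d < 2 ^ (k + 1) := Nat.lt_pow_succ_log_self one_lt_two d
  have hk6 : 6 ≤ k := Nat.le_log_of_pow_le one_lt_two (by omega)
  have hk6' : (6 : ℝ) ≤ k := by exact_mod_cast hk6
  have hL := le_logb_two h1 h2.le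
  have hp : (0 : ℝ) < 2 ^ k := by positivity
  have hdy : (d : ℝ) = d / 2 ^ k * 2 ^ k := by field_simp
  have hy1 : 1 ≤ (d : ℝ) / 2 ^ k := by
    rw [le_div_iff₀ hp, one_mul]; exact_mod_cast h1
  have hy2 : (d : ℝ) / 2 ^ k < 2 := by
    rw [div_lt_iff₀ hp, ← pow_succ']; exact_mod_cast h2
  set y : ℝ := d / 2 ^ k
  have hLk : (k : ℝ) ≤ k - 1 + y := by linarith
  refine hasBadInstance_of_smallSets hA (k := k) (m := k / 2) (by linarith) hL (by linarith) ?_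
    fun b hb => ?_
  -- The difference of the two sides is `(2 - y)((k - 1)^2 - 2y)`; equality at `y = 2` reduces
  -- everything to `sq_mul_pow_le`.
  · have hquad : y * (k + 1) ^ 2 < 2 * (k - 1 + y) ^ 2 := by
      have : 0 < (2 - y) * ((k - 1) ^ 2 - 2 * y) := mul_pos (by linarith) (by nlinarith)
      nlinarith
    have hS := sq_mul_pow_le hk6
    rw [pow_add] at hS
    rw [hdy]
    have h3 : (k + 1 : ℝ) ^ 2 * (2 * (y * 2 ^ k) * k)
        < (k + 1) ^ 2 * (#(smallSets k (k / 2)) * (k - 1 + y) ^ 2) := by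
      calc (k + 1 : ℝ) ^ 2 * (2 * (y * 2 ^ k) * k) = 2 * 2 ^ k * k * (y * (k + 1) ^ 2) := by ring
        _ < 2 * 2 ^ k * k * (2 * (k - 1 + y) ^ 2) := by gcongr
        _ = k * (2 ^ k * 2 ^ 2) * (k - 1 + y) ^ 2 := by ring
        _ ≤ (k + 1) ^ 2 * #(smallSets k (k / 2)) * (k - 1 + y) ^ 2 := by gcongr
        _ = _ := by ring
    exact lt_of_mul_lt_mul_left h3 (by positivity)
  · have hb2 : 2 * (d + 1) ≤ k * b :=
      calc 2 * (d + 1) ≤ 2 * (k / 2 * b) := by omega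
        _ = 2 * (k / 2) * b := by ring
        _ ≤ k * b := Nat.mul_le_mul_right b (by omega)
    have hb' : 2 * ((d : ℝ) + 1) ≤ k * b := by exact_mod_cast hb2
    calc 2 * (d : ℝ) * k < k * b * k := by
          have : 2 * (d : ℝ) < k * b := by linarith
          gcongr
      _ = b * (k : ℝ) ^ 2 := by ring
      _ ≤ b * (k - 1 + y) ^ 2 := by gcongr

/-! ### Dimensions 5 to 15: an explicit decision tree -/

/-- The chord bounds `1 + d/4` and `2 + d/8` have squares exceeding `d` by `(1 - d/4)^2` and `(2 -
d/8)^2`, which vanish only at 4 and 16. -/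
lemma logb_sq_gt {k : ℕ} (hk : k = 2 ∨ k = 3) (h1 : 2 ^ k ≤ d) (h2 : d ≤ 2 ^ (k + 1))
    (hd : d ≠ 4) (hd' : d ≠ 16) : (d : ℝ) < Real.logb 2 d ^ 2 := by
  have hL := le_logb_two h1 h2
  rcases hk with rfl | rfl <;> norm_num at hL
  · have h : 0 < (1 - d / 4 : ℝ) ^ 2 := by
      have : (d : ℝ) ≠ 4 := by exact_mod_cast hd
      exact sq_pos_of_ne_zero fun h => this (by linarith)
    have : (0 : ℝ) ≤ d := by positivity
    nlinarith
  · have h : 0 < (2 - d / 8 : ℝ) ^ 2 := by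
      have : (d : ℝ) ≠ 16 := by exact_mod_cast hd'
      exact sq_pos_of_ne_zero fun h => this (by linarith)
    have : (0 : ℝ) ≤ d := by positivity
    nlinarith

/-- The vectors whose entries are given in hundredths by the lists in `l`. -/
noncomputable def hundredths (d : ℕ) (l : List (List ℕ)) : ℕ → Item d :=
  fun i j => ((l.getD i []).getD j 0 : ℕ) / (100 : ℝ)

lemma hundredths_mem_Icc {l : List (List ℕ)} (hl : ∀ q ∈ l, ∀ a ∈ q, a ≤ 100) (i : ℕ) (j : Fin d) :
    hundredths d l i j ∈ Set.Icc (0 : ℝ) 1 := by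
  have h : (l.getD i []).getD j 0 ≤ 100 := by
    by_cases hi : i < l.length
    · rw [List.getD_eq_getElem _ _ hi]
      by_cases hj : (j : ℕ) < l[i].length
      · rw [List.getD_eq_getElem _ _ hj]
        exact hl _ (List.getElem_mem hi) _ (List.getElem_mem hj)
      · rw [List.getD_eq_default _ _ (not_lt.1 hj)]
        omega
    · rw [List.getD_eq_default _ _ (not_lt.1 hi)]
      simp
  have h' : (((l.getD i []).getD j 0 : ℕ) : ℝ) ≤ 100 := by exact_mod_cast h
  constructor
  · unfold hundredths; positivity
  · unfold hundredths
    rw [div_le_one (by norm_num)]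
    exact h'

/-- Items with total load above one in some coordinate do not share a bin. -/
lemma hundredths_conflict {A : OnlineRule d} (hA : IsOnlineAlgorithm 1 A) (l : List (List ℕ))
    (T : Finset ℕ) (j b : ℕ) (hj : j < d) (hT : ∀ i ∈ T, lab A (hundredths d l) i = b)
    (hl : ∀ q ∈ l, ∀ a ∈ q, a ≤ 100) (hsum : 100 < ∑ i ∈ T, (l.getD i []).getD j 0) : False := by
  have h := (hA.feasible (n := T.sup id + 1) fun i _ => hundredths_mem_Icc hl i).sum_le
    (fun i _ => hundredths_mem_Icc hl i) (T := T)
    (fun i hi => ⟨Nat.lt_succ_of_le (le_sup (f := id) hi), hT i hi⟩) ⟨j, hj⟩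
  have h' : (100 : ℝ) < ∑ i ∈ T, (((l.getD i []).getD j 0 : ℕ) : ℝ) := by exact_mod_cast hsum
  simp only [hundredths] at h
  rw [← sum_div, div_le_iff₀ (by norm_num)] at h
  push_cast at h
  linarith

lemma hundredths_ne {A : OnlineRule d} (hA : IsOnlineAlgorithm 1 A) (l : List (List ℕ))
    (i k j : ℕ) (hj : j < d) (hl : ∀ q ∈ l, ∀ a ∈ q, a ≤ 100)
    (hsum : 100 < ∑ i ∈ {i, k}, (l.getD i []).getD j 0) :
    lab A (hundredths d l) i ≠ lab A (hundredths d l) k := fun h =>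
  hundredths_conflict hA l {i, k} j (lab A (hundredths d l) k) hj (by simpa using h) hl hsum

lemma hundredths_ne_of_eq {A : OnlineRule d} (hA : IsOnlineAlgorithm 1 A) (l : List (List ℕ))
    (i k m j : ℕ) (hj : j < d) (h : lab A (hundredths d l) i = lab A (hundredths d l) k)
    (hl : ∀ q ∈ l, ∀ a ∈ q, a ≤ 100)
    (hsum : 100 < ∑ i ∈ {i, k, m}, (l.getD i []).getD j 0) :
    lab A (hundredths d l) i ≠ lab A (hundredths d l) m := fun h' =>
  hundredths_conflict hA l {i, k, m} j (lab A (hundredths d l) i) hj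
    (by simp [h.symm, h'.symm]) hl hsum

/-- Four bins on an instance with optimum at most two are enough for small dimensions. -/
lemma hasBadInstance_of_four {A : OnlineRule d} (h5 : 5 ≤ d) (h15 : d < 16)
    (l : List (List ℕ)) (c : List ℕ) (p q r s : ℕ)
    (h1 : lab A (hundredths d l) p ≠ lab A (hundredths d l) q)
    (h2 : lab A (hundredths d l) p ≠ lab A (hundredths d l) r)
    (h3 : lab A (hundredths d l) p ≠ lab A (hundredths d l) s)
    (h4 : lab A (hundredths d l) q ≠ lab A (hundredths d l) r)
    (h5' : lab A (hundredths d l) q ≠ lab A (hundredths d l) s)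
    (h6 : lab A (hundredths d l) r ≠ lab A (hundredths d l) s)
    (hl : (∀ q ∈ l, ∀ a ∈ q, a ≤ 100) ∧ ∀ q ∈ l, q.length ≤ 5)
    (hpqrs : ∀ i ∈ [p, q, r, s], i < l.length)
    (hc2 : ∀ i < l.length, c.getD i 0 < 2)
    (hc : ∀ b < 2, ∀ j < 5, ∑ i ∈ range l.length with c.getD i 0 = b, (l.getD i []).getD j 0 ≤ 100) :
    HasBadInstance A := by
  have hf : Feasible 1 (hundredths d l) l.length (fun i => c.getD i 0) := by
    intro b j
    have h : ∑ i ∈ range l.length with c.getD i 0 = b, (l.getD i []).getD j 0 ≤ 100 := by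
      by_cases hb : b < 2
      · by_cases hj : (j : ℕ) < 5
        · exact hc b hb j hj
        · rw [sum_eq_zero]
          · omega
          · intro i hi
            simp only [mem_filter, mem_range] at hi
            rw [List.getD_eq_getElem _ _ hi.1]
            exact List.getD_eq_default _ _
              ((hl.2 _ (List.getElem_mem hi.1)).trans (not_lt.1 hj))
      · rw [sum_eq_zero]
        · omega
        · intro i hi
          simp only [mem_filter, mem_range] at hi
          exact absurd (hi.2 ▸ hc2 i hi.1) hb
    have h' : ∑ i ∈ range l.length with c.getD i 0 = b, (((l.getD i []).getD j 0 : ℕ) : ℝ) ≤ 100 := by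
      exact_mod_cast h
    simp only [hundredths]
    rw [← sum_div, div_le_iff₀ (by norm_num)]
    push_cast
    linarith
  have h4card : 4 ≤ #((range l.length).image (lab A (hundredths d l))) := by
    have hcard : #({lab A (hundredths d l) p, lab A (hundredths d l) q, lab A (hundredths d l) r,
        lab A (hundredths d l) s} : Finset ℕ) = 4 := by
      rw [card_insert_of_notMem (by simp [h1, h2, h3]), card_insert_of_notMem (by simp [h4, h5']),
        card_pair h6]
    rw [← hcard]
    refine card_le_card fun b hb => ?_
    simp only [mem_insert, mem_singleton] at hb
    simp only [List.forall_mem_cons, List.not_mem_nil, false_imp_iff, implies_true, and_true] at hpqrs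
    obtain ⟨hp, hq, hr, hs⟩ := hpqrs
    rw [mem_image]
    rcases hb with rfl | rfl | rfl | rfl
    · exact ⟨p, mem_range.2 hp, rfl⟩
    · exact ⟨q, mem_range.2 hq, rfl⟩
    · exact ⟨r, mem_range.2 hr, rfl⟩
    · exact ⟨s, mem_range.2 hs, rfl⟩
  obtain ⟨I, hI, hopt, hr⟩ := exists_ratio_of_opt_le_two le_rfl (by omega) A
    (fun i _ => hundredths_mem_Icc hl.1 i) (opt_seq_le_of_lt hf hc2) h4card
  have hsq : (d : ℝ) < Real.logb 2 d ^ 2 := by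
    by_cases h8 : d ≤ 8
    · exact logb_sq_gt (Or.inl rfl) (by omega) (by omega) (by omega) (by omega)
    · exact logb_sq_gt (Or.inr rfl) (by omega) (by omega) (by omega) (by omega)
  have hd0 : (0 : ℝ) < d := by exact_mod_cast (by omega : 0 < d)
  refine ⟨I, hI, ?_, lt_of_lt_of_le ?_ hr⟩
  · rw [hopt, Real.le_logb_iff_rpow_le one_lt_two hd0]
    have : (5 : ℝ) ≤ d := by exact_mod_cast h5
    norm_num
    linarith
  · rw [div_lt_iff₀ (hd0.trans hsq)]
    push_cast
    linarith

/-- The adversary for small dimensions: it forces four bins while the optimum is at most two. -/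
lemma hasBadInstance_of_lt_sixteen {A : OnlineRule d} (hA : IsOnlineAlgorithm 1 A)
    (h5 : 5 ≤ d) (h15 : d < 16) : HasBadInstance A := by
  let s : List ℕ := [50, 1, 0, 1, 0]
  -- Labels depend only on the items so far, so facts about a short list hold definitionally for its
  -- extensions.
  by_cases hst : lab A (hundredths d [s, s]) 0 = lab A (hundredths d [s, s]) 1
  -- The bin with both copies of `s` is full at coordinate 0, and every later item of this branch is
  -- positive there.
  · let a : List ℕ := [1, 0, 100, 0, 0]
    let b : List ℕ := [1, 0, 0, 0, 100]
    by_cases hab : lab A (hundredths d [s, s, a, b]) 2 = lab A (hundredths d [s, s, a, b]) 3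
    · let l : List (List ℕ) := [s, s, a, b, [1, 90, 0, 0, 1], [1, 20, 1, 0, 0]]
      have h34 := hundredths_ne hA l 3 4 4 (by omega) (by decide) (by decide)
      exact hasBadInstance_of_four h5 h15 l [0, 1, 0, 1, 0, 1] 0 2 4 5
        (hundredths_ne_of_eq hA l 0 1 2 0 (by omega) hst (by decide) (by decide))
        (hundredths_ne_of_eq hA l 0 1 4 0 (by omega) hst (by decide) (by decide))
        (hundredths_ne_of_eq hA l 0 1 5 0 (by omega) hst (by decide) (by decide))
        (fun h => h34 (Eq.trans (Eq.symm hab) h))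
        (hundredths_ne hA l 2 5 2 (by omega) (by decide) (by decide))
        (hundredths_ne hA l 4 5 1 (by omega) (by decide) (by decide))
        (by decide) (by decide) (by decide) (by decide)
    · let l : List (List ℕ) := [s, s, a, b, [1, 0, 1, 0, 1]]
      exact hasBadInstance_of_four h5 h15 l [0, 1, 0, 0, 1] 0 2 3 4
        (hundredths_ne_of_eq hA l 0 1 2 0 (by omega) hst (by decide) (by decide))
        (hundredths_ne_of_eq hA l 0 1 3 0 (by omega) hst (by decide) (by decide))
        (hundredths_ne_of_eq hA l 0 1 4 0 (by omega) hst (by decide) (by decide))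
        hab
        (hundredths_ne hA l 2 4 2 (by omega) (by decide) (by decide))
        (hundredths_ne hA l 3 4 4 (by omega) (by decide) (by decide))
        (by decide) (by decide) (by decide) (by decide)
  -- Now `r` needs a third bin, so a fourth is the goal. If `u` joins `r`, a unit vector at
  -- coordinate 1 conflicts with both copies of `s` and with `u`.
  · let r : List ℕ := [51, 0, 0, 0, 100]
    let u : List ℕ := [0, 98, 100, 0, 0]
    have h02 := hundredths_ne hA [s, s, r, u] 0 2 0 (by omega) (by decide) (by decide)
    have h12 := hundredths_ne hA [s, s, r, u] 1 2 0 (by omega) (by decide) (by decide)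
    by_cases h23 : lab A (hundredths d [s, s, r, u]) 2 = lab A (hundredths d [s, s, r, u]) 3
    · let l : List (List ℕ) := [s, s, r, u, [0, 100, 0, 0, 0]]
      have h34 := hundredths_ne hA l 3 4 1 (by omega) (by decide) (by decide)
      exact hasBadInstance_of_four h5 h15 l [0, 0, 1, 0, 1] 0 1 2 4 hst h02
        (hundredths_ne hA l 0 4 1 (by omega) (by decide) (by decide)) h12
        (hundredths_ne hA l 1 4 1 (by omega) (by decide) (by decide))
        (fun h => h34 (Eq.trans (Eq.symm h23) h))
        (by decide) (by decide) (by decide) (by decide)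
    by_cases h03 : lab A (hundredths d [s, s, r, u]) 0 = lab A (hundredths d [s, s, r, u]) 3 ∨
        lab A (hundredths d [s, s, r, u]) 1 = lab A (hundredths d [s, s, r, u]) 3
    -- Here `u` joined a copy of `s`, and that bin cannot take `v`: coordinate 1 would reach 1.01.
    -- If `v` joins the other copy, an item positive at coordinates 2, 3, 4 is barred from all three
    -- bins.
    · let v : List ℕ := [0, 2, 0, 98, 0]
      let l : List (List ℕ) := [s, s, r, u, v]
      by_cases h24 : lab A (hundredths d l) 2 = lab A (hundredths d l) 4
      · let l' : List (List ℕ) := [s, s, r, u, v, [0, 0, 0, 100, 0]]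
        have h45 := hundredths_ne hA l' 4 5 3 (by omega) (by decide) (by decide)
        exact hasBadInstance_of_four h5 h15 l' [0, 0, 1, 1, 0, 1] 0 1 2 5 hst h02
          (hundredths_ne hA l' 0 5 3 (by omega) (by decide) (by decide)) h12
          (hundredths_ne hA l' 1 5 3 (by omega) (by decide) (by decide))
          (fun h => h45 (Eq.trans (Eq.symm h24) h))
          (by decide) (by decide) (by decide) (by decide)
      by_cases h04 : lab A (hundredths d l) 0 = lab A (hundredths d l) 4 ∨
          lab A (hundredths d l) 1 = lab A (hundredths d l) 4
      · let l' : List (List ℕ) := [s, s, r, u, v, [0, 0, 10, 10, 10]]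
        have h25 := hundredths_ne hA l' 2 5 4 (by omega) (by decide) (by decide)
        have h35 := hundredths_ne hA l' 3 5 2 (by omega) (by decide) (by decide)
        have h45 := hundredths_ne hA l' 4 5 3 (by omega) (by decide) (by decide)
        have key : lab A (hundredths d l') 0 ≠ lab A (hundredths d l') 5 ∧
            lab A (hundredths d l') 1 ≠ lab A (hundredths d l') 5 := by
          rcases h03 with h3 | h3 <;> rcases h04 with h4 | h4
          · exact (hundredths_ne_of_eq hA l 0 3 4 1 (by omega) h3 (by decide) (by decide) h4).elim
          · exact ⟨fun h => h35 (Eq.trans (Eq.symm h3) h), fun h => h45 (Eq.trans (Eq.symm h4) h)⟩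
          · exact ⟨fun h => h45 (Eq.trans (Eq.symm h4) h), fun h => h35 (Eq.trans (Eq.symm h3) h)⟩
          · exact (hundredths_ne_of_eq hA l 1 3 4 1 (by omega) h3 (by decide) (by decide) h4).elim
        exact hasBadInstance_of_four h5 h15 l' [0, 0, 1, 1, 1, 0] 0 1 2 5 hst h02 key.1 h12 key.2
          h25 (by decide) (by decide) (by decide) (by decide)
      · rw [not_or] at h04
        exact hasBadInstance_of_four h5 h15 l [0, 0, 1, 1, 1] 0 1 2 4 hst h02 h04.1 h12 h04.2
          h24 (by decide) (by decide) (by decide) (by decide)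
    · rw [not_or] at h03
      exact hasBadInstance_of_four h5 h15 [s, s, r, u] [0, 0, 1, 0] 0 1 2 3 hst h02 h03.1 h12
        h03.2 h23 (by decide) (by decide) (by decide) (by decide)

theorem lower_bound_of_one {A : OnlineRule d} (hA : IsOnlineAlgorithm 1 A) (h5 : 5 ≤ d) :
    HasBadInstance A := by
  rcases lt_or_ge d 16 with h16 | h16
  · exact hasBadInstance_of_lt_sixteen hA h5 h16
  rcases lt_or_ge d 32 with h32 | h32
  · exact hasBadInstance_of_mem_sixteen hA h16 h32
  rcases lt_or_ge d 64 with h64 | h64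
  · exact hasBadInstance_of_mem_thirtyTwo hA h32 h64
  exact hasBadInstance_of_le_sixtyFour hA h64

end OVBP

theorem mainTheorem6 (d : ℕ) (hd : 1 ≤ d) :
    (∃ I : List (OVBP.Item d), OVBP.IsInstance I ∧ OVBP.opt 1 I = 2 ∧
      (d : ℝ) / 4 ≤ OVBP.ratio 1 (OVBP.firstFit d 1) I) ∧
    (5 ≤ d → ∀ A : OVBP.OnlineRule d, OVBP.IsOnlineAlgorithm 1 A →
      ∃ I : List (OVBP.Item d), OVBP.IsInstance I ∧
        (OVBP.opt 1 I : ℝ) ≤ Real.logb 2 d ∧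
        2 * (d : ℝ) / (Real.logb 2 d) ^ 2 < OVBP.ratio 1 A I) ∧
    (∀ B : ℕ, 2 ≤ B → ∀ A : OVBP.OnlineRule d, OVBP.IsOnlineAlgorithm B A →
      ∃ I : List (OVBP.Item d), OVBP.IsInstance I ∧ OVBP.opt B I = 2 ∧
        ((((B.factorial : ℝ) * (d : ℝ)) ^ ((1 : ℝ) / (B : ℝ)) - 1) / (2 * (B : ℝ)))
          < OVBP.ratio B A I) :=
  ⟨OVBP.firstFit_lower_bound hd, fun h5 _ hA => OVBP.lower_bound_of_one hA h5,
    fun _ hB _ hA => OVBP.lower_bound_of_two_le hd hB hA⟩
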